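/- Consider a multi-agent bandit with $N\ge 2$ agents and $K\ge 1$ arms. Arm $k$ has a reward law $\nu_k$, an arbitrary probability distribution on $[0,1]^N$: each pull of arm $k$ gives every agent $i$ a reward, the reward vector being drawn from $\nu_k$ independently of the past. Let $\mu^*_{i,k}$ be the mean reward of agent $i$ from arm $k$. A policy is a probability vector $p=(p_1,\dots,p_K)$. For an $N\times K$ matrix $m$ put $$D_m(p)=\frac{2}{N(N-1)}\sum_{i>j}\Big(\sum_k p_k m_{i,k}-\sum_k p_k m_{j,k}\Big)^2,\qquad D=D_{\mu^*},$$ and let $P^*$ be a policy that minimizes $D$. The equality-fairness algorithm with parameter $\alpha$ proceeds in rounds $t=0,1,2,\dots$, where round $t$ takes place after $t$ pulls have been made. In the first $K$ rounds it pulls every arm once (the policy $P_t$ of such a round is the point mass at the arm pulled). In a round $t\ge K$, let $n^t_k$ be the number of earlier pulls of arm $k$ and $\hat\mu^t_{i,k}$ the empirical mean of the rewards that agent $i$ received in them; the algorithm chooses (as a function of the past, ties being broken in any measurable way) a policy $P_t$ that minimizes $$D_{\hat\mu^t}(p)-\alpha\sum_k p_k\sqrt{\frac{2\ln(NKt)}{n^t_k}}$$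 over all policies $p$, samples an arm from $P_t$, pulls it and observes the rewards of all agents. **Theorem.** Let $\alpha=4$. The expected regret of the equality-fairness algorithm is $O\big(\sqrt{KT\ln(NKT)}\big)$: there is an absolute constant $C>0$ such that for all $N\ge 2$, $K\ge 1$, $T\ge 1$, all reward laws $\nu_1,\dots,\nu_K$ on $[0,1]^N$, every optimal policy $P^*$ and every run of the algorithm through round $T$, the regret $R^{EF}(T)=\sum_{t=0}^{T}\big[D(P_t)-D(P^*)\big]$ is integrable and $$\mathbb E\big[R^{EF}(T)\big]\le C\sqrt{KT\ln(NKT)}.$$ -/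

import Mathlib

open MeasureTheory

noncomputable section

namespace FairBandit

/-- Pairwise disparity `D(p)` of the policy `p` under the `N × K` matrix of means `m`:
`2 / (N (N - 1)) * ∑_{i > j} (∑ k, p k * m i k - ∑ k, p k * m j k) ^ 2`. -/
def disparity {N K : ℕ} (m : Fin N → Fin K → ℝ) (p : Fin K → ℝ) : ℝ :=
  2 / ((N : ℝ) * ((N : ℝ) - 1)) *
    ∑ i : Fin N, ∑ j ∈ Finset.Iio i, (∑ k, p k * m i k - ∑ k, p k * m j k) ^ 2

/-- The true means: `trueMean ν i k` is the mean reward of agent `i` when arm `k` is pulled, where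
`ν k` is the joint law on `ℝ ^ N` of the agents' rewards from arm `k`. -/
def trueMean {N K : ℕ} (ν : Fin K → Measure (Fin N → ℝ)) (i : Fin N) (k : Fin K) : ℝ :=
  ∫ x, x i ∂(ν k)

/-- Number of pulls of arm `k` among the first `t` rounds (rounds `0, …, t - 1`), when arm `a s` is
pulled in round `s`. -/
def pullCount {K : ℕ} (a : ℕ → Fin K) (t : ℕ) (k : Fin K) : ℕ :=
  ((Finset.range t).filter fun s => a s = k).card

/-- Empirical mean reward of agent `i` from arm `k` after the first `t` rounds, when the reward
vector `x s` is observed in round `s`. -/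
def empMean {N K : ℕ} (a : ℕ → Fin K) (x : ℕ → Fin N → ℝ) (t : ℕ) (i : Fin N) (k : Fin K) : ℝ :=
  (∑ s ∈ (Finset.range t).filter (fun s => a s = k), x s i) / (pullCount a t k : ℝ)

/-- The confidence radius `√(2 ln(N K t) / n)` of an arm that has been pulled `n` times. -/
def confRadius (N K t n : ℕ) : ℝ :=
  Real.sqrt (2 * Real.log ((N : ℝ) * (K : ℝ) * (t : ℝ)) / (n : ℝ))

/-- The objective that the optimization step minimizes over policies `p` once `t` pulls have been
made: the empirical disparity minus `α` times the `p`-average of the confidence radii. -/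
def efObjective {N K : ℕ} (α : ℝ) (a : ℕ → Fin K) (x : ℕ → Fin N → ℝ) (t : ℕ)
    (p : Fin K → ℝ) : ℝ :=
  disparity (empMean a x t) p - α * ∑ k, p k * confRadius N K t (pullCount a t k)

/-- `p` is a minimizer of `f` over the policies (the probability vectors on the `K` arms). -/
def IsOptimalPolicy {K : ℕ} (f : (Fin K → ℝ) → ℝ) (p : Fin K → ℝ) : Prop :=
  p ∈ stdSimplex ℝ (Fin K) ∧ IsMinOn f (stdSimplex ℝ (Fin K)) p

/-- A run, through round `T`, of the equality-fairness algorithm with parameter `α` on the bandit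
with reward laws `ν`. Round `t = 0, 1, …, T` takes place when `t` pulls have been made; in it the
policy `P t` is used, the arm `A t` is pulled and the vector `X t` of the agents' rewards is
observed. `ℱ t` is the information available before round `t`.
* Rounds `t < K` pull each arm once.
* In the rounds `t ≥ K` the policy solves the optimization step (ties are broken in any way that is
  measurable with respect to the past).
* Given the past, the arm is sampled from `P t`, and the reward vector then has the law of that
  arm: `Pr (A t = k, X t ∈ B | ℱ t) = P t k * ν k B`. -/
structure IsEFRun {N K : ℕ} {Ω : Type*} {mΩ : MeasurableSpace Ω} (Pr : Measure Ω)
    (ν : Fin K → Measure (Fin N → ℝ)) (α : ℝ) (T : ℕ) (ℱ : Filtration ℕ mΩ)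
    (P : ℕ → Ω → Fin K → ℝ) (A : ℕ → Ω → Fin K) (X : ℕ → Ω → Fin N → ℝ) : Prop where
  measurable_policy : ∀ t ≤ T, Measurable[ℱ t] (P t)
  measurable_arm : ∀ t ≤ T, Measurable[ℱ (t + 1)] (A t)
  measurable_reward : ∀ t ≤ T, Measurable[ℱ (t + 1)] (X t)
  init : ∀ t ≤ T, ∀ ht : t < K, ∀ᵐ ω ∂Pr, P t ω = Pi.single ⟨t, ht⟩ 1
  optimize : ∀ t ≤ T, K ≤ t → ∀ᵐ ω ∂Pr,
    IsOptimalPolicy (efObjective α (fun s => A s ω) (fun s => X s ω) t) (P t ω)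
  sample : ∀ t ≤ T, ∀ (k : Fin K) (B : Set (Fin N → ℝ)), MeasurableSet B →
    Pr[{ω | A t ω = k ∧ X t ω ∈ B}.indicator (fun _ => (1 : ℝ)) | ℱ t]
      =ᵐ[Pr] fun ω => P t ω k * (ν k).real B

/-- The equality-fairness regret `∑_t (D(P_t) - D(P*))` over all rounds `t = 0, …, T`, the `K`
initial pulls included, on one path `p 0, p 1, …` of policies; `m` is the matrix of true means. -/
def efRegret {N K : ℕ} (m : Fin N → Fin K → ℝ) (pstar : Fin K → ℝ) (p : ℕ → Fin K → ℝ)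
    (T : ℕ) : ℝ :=
  ∑ t ∈ Finset.range (T + 1), (disparity m (p t) - disparity m pstar)

end FairBandit

end

/-!
Optimism in the face of uncertainty. If every empirical mean is within its confidence radius
`r k`, then the estimated disparity of every policy `p` is within `4 ∑ p k * r k` of the true one:
the difference of two squared gaps factors into a term at most `2 ∑ p k * r k` and a term at most
`2`. The parameter `α = 4` therefore makes the objective a lower bound of the true disparity, and a
minimizer is suboptimal by at most `8 ∑ P t k * r k` (`disparity_sub_le_of_isOptimalPolicy`).

Because the arm is drawn from `P t`, this bonus has the same expectation as the radius of the arm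
actually pulled (`IsEFRun.integral_sum_policy_mul_confRadius`). Along any path these radii sum to
`O(√(K T ln (N K T)))`, since `∑ 1 / √n` over the pulls of an arm is `O(√n)` and
`∑ √n_k ≤ √(K ∑ n_k)` (`sum_confRadius_le`).

The confidence intervals rest on an exponential supermartingale (`tiltedSum`,
`IsEFRun.lintegral_exp_tiltedSum_le_one`): given the past, a pull of arm `k` yields a reward with law
`ν k`, so Hoeffding's lemma bounds each factor. Markov's inequality with the tilt adapted to each
possible number of pulls, and a union bound over agents, arms, pull numbers and signs, show that a
confidence interval fails in round `t` with probability at most `2 / (N K t) ^ 3`, which is summable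
(`IsEFRun.exists_confidence_event`). The initial rounds cost at most `min K (T + 1)`, again
`O(√(K T))`.
-/

namespace FairBandit

/-! ### Disparity as a function of the means -/

theorem sum_pairs_le {N : ℕ} (hN : 2 ≤ N) {x : Fin N → Fin N → ℝ} {c : ℝ}
    (h : ∀ i j, x i j ≤ c) :
    2 / ((N : ℝ) * ((N : ℝ) - 1)) * ∑ i : Fin N, ∑ j ∈ Finset.Iio i, x i j ≤ c := by
  have hN' : (2 : ℝ) ≤ N := by exact_mod_cast hN
  have hpos : 0 < (N : ℝ) * ((N : ℝ) - 1) := by nlinarith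
  have hcount : (∑ i : Fin N, ((i : ℕ) : ℝ)) * 2 = (N : ℝ) * ((N : ℝ) - 1) := by
    rw [Fin.sum_univ_eq_sum_range (fun n => (n : ℝ)) N]
    have := Finset.sum_range_id_mul_two N
    have h2 : (((∑ i ∈ Finset.range N, i) * 2 : ℕ) : ℝ) = ((N * (N - 1) : ℕ) : ℝ) := by rw [this]
    push_cast [Nat.cast_sub (show 1 ≤ N by omega)] at h2
    exact h2
  have hle : ∑ i : Fin N, ∑ j ∈ Finset.Iio i, x i j ≤ (∑ i : Fin N, ((i : ℕ) : ℝ)) * c := by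
    rw [Finset.sum_mul]
    refine Finset.sum_le_sum fun i _ => ?_
    refine (Finset.sum_le_sum fun j _ => h i j).trans ?_
    simp
  rw [div_mul_eq_mul_div, div_le_iff₀ hpos, ← hcount]
  linarith

theorem disparity_nonneg {N K : ℕ} (hN : 2 ≤ N) (m : Fin N → Fin K → ℝ) (p : Fin K → ℝ) :
    0 ≤ disparity m p := by
  have hN' : (2 : ℝ) ≤ N := by exact_mod_cast hN
  have hpos : 0 < (N : ℝ) * ((N : ℝ) - 1) := by nlinarith
  unfold disparity
  positivity

theorem sum_mul_mem_Icc {K : ℕ} {p v : Fin K → ℝ} (hp : p ∈ stdSimplex ℝ (Fin K))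
    (hv : ∀ k, v k ∈ Set.Icc (0 : ℝ) 1) : ∑ k, p k * v k ∈ Set.Icc (0 : ℝ) 1 := by
  refine ⟨Finset.sum_nonneg fun k _ => mul_nonneg (hp.1 k) (hv k).1, ?_⟩
  rw [← hp.2]
  exact Finset.sum_le_sum fun k _ => mul_le_of_le_one_right (hp.1 k) (hv k).2

theorem disparity_le_one {N K : ℕ} (hN : 2 ≤ N) {m : Fin N → Fin K → ℝ} {p : Fin K → ℝ}
    (hp : p ∈ stdSimplex ℝ (Fin K)) (hm : ∀ i k, m i k ∈ Set.Icc (0 : ℝ) 1) :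
    disparity m p ≤ 1 := by
  refine sum_pairs_le hN fun i j => ?_
  have hi := sum_mul_mem_Icc hp (hm i)
  have hj := sum_mul_mem_Icc hp (hm j)
  rw [sq_le_one_iff_abs_le_one, abs_le]
  constructor <;> linarith [hi.1, hi.2, hj.1, hj.2]

theorem disparity_sub_le {N K : ℕ} (hN : 2 ≤ N) {m m' : Fin N → Fin K → ℝ} {p r : Fin K → ℝ}
    (hp : p ∈ stdSimplex ℝ (Fin K)) (hm : ∀ i k, m i k ∈ Set.Icc (0 : ℝ) 1)
    (hm' : ∀ i k, m' i k ∈ Set.Icc (0 : ℝ) 1) (hr : ∀ i k, |m i k - m' i k| ≤ r k) :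
    disparity m p - disparity m' p ≤ 4 * ∑ k, p k * r k := by
  unfold disparity
  rw [← mul_sub, ← Finset.sum_sub_distrib,
    Finset.sum_congr rfl fun i _ => (Finset.sum_sub_distrib _ _).symm]
  refine sum_pairs_le hN fun i j => ?_
  have key : ∀ i, |∑ k, p k * m i k - ∑ k, p k * m' i k| ≤ ∑ k, p k * r k := fun i => by
    rw [← Finset.sum_sub_distrib]
    refine (Finset.abs_sum_le_sum_abs _ _).trans (Finset.sum_le_sum fun k _ => ?_)
    rw [← mul_sub, abs_mul, abs_of_nonneg (hp.1 k)]
    exact mul_le_mul_of_nonneg_left (hr i k) (hp.1 k)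
  have hi := sum_mul_mem_Icc hp (hm i)
  have hj := sum_mul_mem_Icc hp (hm j)
  have hi' := sum_mul_mem_Icc hp (hm' i)
  have hj' := sum_mul_mem_Icc hp (hm' j)
  have ki := key i
  have kj := key j
  generalize ∑ k, p k * m i k = a at *
  generalize ∑ k, p k * m j k = b at *
  generalize ∑ k, p k * m' i k = a' at *
  generalize ∑ k, p k * m' j k = b' at *
  generalize ∑ k, p k * r k = R at *
  -- difference of squares: the first factor is at most `2 R`, the second at most `2`
  have h1 : |(a - b) - (a' - b')| ≤ 2 * R := by
    rw [abs_le] at *; constructor <;> linarith [ki.1, ki.2, kj.1, kj.2]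
  have h2 : |(a - b) + (a' - b')| ≤ 2 := by
    rw [abs_le]
    constructor <;> linarith [hi.1, hi.2, hj.1, hj.2, hi'.1, hi'.2, hj'.1, hj'.2]
  calc (a - b) ^ 2 - (a' - b') ^ 2 = ((a - b) - (a' - b')) * ((a - b) + (a' - b')) := by ring
    _ ≤ |((a - b) - (a' - b')) * ((a - b) + (a' - b'))| := le_abs_self _
    _ = |(a - b) - (a' - b')| * |(a - b) + (a' - b')| := abs_mul _ _
    _ ≤ 2 * R * 2 := mul_le_mul h1 h2 (abs_nonneg _) ((abs_nonneg _).trans h1)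
    _ = 4 * R := by ring

/-- Optimism: when the confidence intervals hold, the bonus `4 ∑ p r` dominates the error of the
estimated disparity, so a minimizer `p` of the optimistic objective is suboptimal by at most twice
its own bonus. -/
theorem disparity_sub_le_of_isOptimalPolicy {N K : ℕ} (hN : 2 ≤ N) {m m' : Fin N → Fin K → ℝ}
    {p q r : Fin K → ℝ} (hq : q ∈ stdSimplex ℝ (Fin K))
    (hm : ∀ i k, m i k ∈ Set.Icc (0 : ℝ) 1) (hm' : ∀ i k, m' i k ∈ Set.Icc (0 : ℝ) 1)
    (hr : ∀ i k, |m' i k - m i k| ≤ r k)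
    (hp : IsOptimalPolicy (fun p => disparity m' p - 4 * ∑ k, p k * r k) p) :
    disparity m p - disparity m q ≤ 8 * ∑ k, p k * r k := by
  have h1 := disparity_sub_le hN hp.1 hm hm' fun i k => (abs_sub_comm _ _).trans_le (hr i k)
  have h2 := disparity_sub_le hN hq hm' hm hr
  have h3 := hp.2 hq
  simp only [Set.mem_ofPred_eq] at h3
  linarith

theorem continuous_disparity {N K : ℕ} (m : Fin N → Fin K → ℝ) : Continuous (disparity m) := by
  unfold disparity
  fun_prop

/-! ### Pull counts and empirical means -/

theorem pullCount_succ {K : ℕ} (a : ℕ → Fin K) (t : ℕ) (k : Fin K) :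
    pullCount a (t + 1) k = pullCount a t k + if a t = k then 1 else 0 := by
  unfold pullCount
  rw [Finset.card_filter, Finset.card_filter, Finset.sum_range_succ]

theorem pullCount_le {K : ℕ} (a : ℕ → Fin K) (t : ℕ) (k : Fin K) : pullCount a t k ≤ t := by
  simpa [pullCount] using Finset.card_filter_le (Finset.range t) fun s => a s = k

theorem sum_pullCount {K : ℕ} (a : ℕ → Fin K) (t : ℕ) : ∑ k, pullCount a t k = t := by
  induction t with
  | zero => simp [pullCount]
  | succ t ih => simp [pullCount_succ, Finset.sum_add_distrib, ih]

theorem pullCount_pos {K : ℕ} {a : ℕ → Fin K} {s t : ℕ} (h : s < t) :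
    0 < pullCount a t (a s) :=
  Finset.card_pos.2 ⟨s, by simp [h]⟩

theorem empMean_mem_Icc {N K : ℕ} {a : ℕ → Fin K} {x : ℕ → Fin N → ℝ} {t : ℕ}
    (hx : ∀ s < t, ∀ i, x s i ∈ Set.Icc (0 : ℝ) 1) (i : Fin N) (k : Fin K) :
    empMean a x t i k ∈ Set.Icc (0 : ℝ) 1 := by
  unfold empMean pullCount
  have hx' : ∀ s ∈ (Finset.range t).filter (fun s => a s = k), x s i ∈ Set.Icc (0 : ℝ) 1 :=
    fun s hs => hx s (by simpa using (Finset.mem_filter.1 hs).1) i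
  refine ⟨div_nonneg (Finset.sum_nonneg fun s hs => (hx' s hs).1) (Nat.cast_nonneg _),
    div_le_one_of_le₀ ?_ (Nat.cast_nonneg _)⟩
  refine (Finset.sum_le_sum fun s hs => (hx' s hs).2).trans ?_
  simp

/-- Summing the widths `1 / √n` along the pulls. The factor `3` makes the step
`1 / √n + 3 √n ≤ 3 √(n + 1)` hold for every `n ≥ 1`; for `n = 0` the junk value `1 / √0 = 0` is
harmless. -/
theorem sum_inv_sqrt_pullCount_le {K : ℕ} (a : ℕ → Fin K) (t : ℕ) :
    ∑ s ∈ Finset.range t, (√(pullCount a s (a s) : ℝ))⁻¹ ≤ 3 * ∑ k, √(pullCount a t k : ℝ) := by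
  induction t with
  | zero => simp [pullCount]
  | succ t ih =>
    have step : ∀ n : ℕ, (√(n : ℝ))⁻¹ + 3 * √(n : ℝ) ≤ 3 * √((n + 1 : ℕ) : ℝ) := fun n => by
      rcases Nat.eq_zero_or_pos n with rfl | hn
      · simp
      · have hn' : (1 : ℝ) ≤ n := by exact_mod_cast hn
        have hs : 0 < √(n : ℝ) := Real.sqrt_pos.2 (by linarith)
        have hsq := Real.sq_sqrt (show (0 : ℝ) ≤ n by linarith)
        have : (√(n : ℝ))⁻¹ / 3 + √(n : ℝ) ≤ √((n + 1 : ℕ) : ℝ) := by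
          refine Real.le_sqrt_of_sq_le ?_
          have h1 : ((√(n : ℝ))⁻¹) ^ 2 ≤ 1 := by
            rw [inv_pow, hsq]; exact inv_le_one_of_one_le₀ hn'
          have h2 : (√(n : ℝ))⁻¹ * √(n : ℝ) = 1 := inv_mul_cancel₀ hs.ne'
          push_cast
          nlinarith
        linarith
    rw [Finset.sum_range_succ]
    have hsplit : ∑ k, √(pullCount a (t + 1) k : ℝ)
        = ∑ k, √(pullCount a t k : ℝ)
          + (√((pullCount a t (a t) + 1 : ℕ) : ℝ) - √(pullCount a t (a t) : ℝ)) := by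
      rw [← sub_eq_iff_eq_add', ← Finset.sum_sub_distrib, Finset.sum_eq_single (a t)]
      · simp [pullCount_succ]
      · intro k _ hk
        simp [pullCount_succ, hk.symm]
      · simp
    rw [hsplit]
    linarith [step (pullCount a t (a t))]

theorem sum_sqrt_pullCount_le {K : ℕ} (a : ℕ → Fin K) (t : ℕ) :
    ∑ k, √(pullCount a t k : ℝ) ≤ √((K : ℝ) * t) := by
  refine Real.le_sqrt_of_sq_le ?_
  refine (sq_sum_le_card_mul_sum_sq (s := Finset.univ)).trans_eq ?_
  simp only [Finset.card_univ, Fintype.card_fin, Nat.cast_nonneg, Real.sq_sqrt]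
  rw [← Nat.cast_sum, sum_pullCount]

theorem confRadius_le {N K t T n : ℕ} (hN : 1 ≤ N) (hK : 1 ≤ K) (hT : 1 ≤ T) (ht : t ≤ T) :
    confRadius N K t n ≤ √(2 * Real.log ((N : ℝ) * K * T)) * (√(n : ℝ))⁻¹ := by
  have hN' : (1 : ℝ) ≤ N := by exact_mod_cast hN
  have hK' : (1 : ℝ) ≤ K := by exact_mod_cast hK
  have hT' : (1 : ℝ) ≤ T := by exact_mod_cast hT
  have ht' : (t : ℝ) ≤ T := by exact_mod_cast ht
  have hNK : 1 ≤ (N : ℝ) * K := by nlinarith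
  have hlog : 0 ≤ Real.log ((N : ℝ) * K * T) := Real.log_nonneg (by nlinarith)
  have hle : Real.log ((N : ℝ) * K * t) ≤ Real.log ((N : ℝ) * K * T) := by
    rcases Nat.eq_zero_or_pos t with rfl | h
    · simpa using hlog
    · have : (0 : ℝ) < t := by exact_mod_cast h
      exact Real.log_le_log (by positivity) (by gcongr)
  unfold confRadius
  rw [Real.sqrt_div' _ (Nat.cast_nonneg n), div_eq_mul_inv]
  gcongr

/-- The confidence radii of the arms pulled in rounds `0, …, T` sum to `O(√(K T ln (N K T)))` on
every path. -/
theorem sum_confRadius_le {N K T : ℕ} (hN : 1 ≤ N) (hK : 1 ≤ K) (hT : 1 ≤ T) (a : ℕ → Fin K) :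
    ∑ t ∈ Finset.range (T + 1), confRadius N K t (pullCount a t (a t))
      ≤ 6 * √((K : ℝ) * T * Real.log ((N : ℝ) * K * T)) := by
  have hT' : (1 : ℝ) ≤ T := by exact_mod_cast hT
  calc ∑ t ∈ Finset.range (T + 1), confRadius N K t (pullCount a t (a t))
      ≤ ∑ t ∈ Finset.range (T + 1),
          √(2 * Real.log ((N : ℝ) * K * T)) * (√(pullCount a t (a t) : ℝ))⁻¹ :=
        Finset.sum_le_sum fun t ht =>
          confRadius_le hN hK hT (Nat.lt_succ_iff.1 (Finset.mem_range.1 ht))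
    _ ≤ √(2 * Real.log ((N : ℝ) * K * T)) * (3 * √((K : ℝ) * (T + 1 : ℕ))) := by
        rw [← Finset.mul_sum]
        refine mul_le_mul_of_nonneg_left ?_ (Real.sqrt_nonneg _)
        exact (sum_inv_sqrt_pullCount_le a _).trans
          (mul_le_mul_of_nonneg_left (sum_sqrt_pullCount_le a _) (by norm_num))
    _ ≤ √(2 * Real.log ((N : ℝ) * K * T)) * (3 * √(2 * ((K : ℝ) * T))) := by
        refine mul_le_mul_of_nonneg_left (mul_le_mul_of_nonneg_left (Real.sqrt_le_sqrt ?_)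
          (by norm_num)) (Real.sqrt_nonneg _)
        push_cast
        nlinarith [(Nat.cast_nonneg K : (0 : ℝ) ≤ K)]
    _ = 6 * √((K : ℝ) * T * Real.log ((N : ℝ) * K * T)) := by
        rw [Real.sqrt_mul (by norm_num), Real.sqrt_mul (by norm_num) ((K : ℝ) * T),
          Real.sqrt_mul (by positivity : (0 : ℝ) ≤ (K : ℝ) * T)]
        have := Real.mul_self_sqrt (show (0 : ℝ) ≤ 2 by norm_num)
        linear_combination (3 * √(Real.log ((N : ℝ) * K * T)) * √((K : ℝ) * T)) * this

/-! ### Conditional sampling -/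

open scoped ENNReal in
/-- If, given `m`, the event `E` has probability `q` and the variable `X` has law `ν` on `E`, then
on `E` the expectation of an `m`-measurable factor times a function of `X` splits. -/
theorem setLIntegral_mul_comp_eq_of_condExp {Ω S : Type*} {m mΩ : MeasurableSpace Ω}
    [MeasurableSpace S] (hm : m ≤ mΩ) {Pr : Measure Ω} [IsProbabilityMeasure Pr] {ν : Measure S}
    [IsProbabilityMeasure ν] {E : Set Ω} (hE : MeasurableSet E) {X : Ω → S} (hX : Measurable X)
    {q : Ω → ℝ}
    (h : ∀ B, MeasurableSet B → Pr[{ω | ω ∈ E ∧ X ω ∈ B}.indicator (fun _ => (1 : ℝ)) | m]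
      =ᵐ[Pr] fun ω => q ω * ν.real B)
    {f : Ω → ℝ≥0∞} (hf : Measurable[m] f) {g : S → ℝ≥0∞} (hg : Measurable g) :
    ∫⁻ ω in E, f ω * g (X ω) ∂Pr = (∫⁻ ω, f ω * ENNReal.ofReal (q ω) ∂Pr) * ∫⁻ x, g x ∂ν := by
  have hmeas : ∀ B, MeasurableSet B → MeasurableSet {ω | ω ∈ E ∧ X ω ∈ B} :=
    fun B hB => hE.inter (hX hB)
  have hq := h Set.univ MeasurableSet.univ
  simp only [probReal_univ, mul_one] at hq
  have hq_int : Integrable q Pr := integrable_condExp.congr hq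
  have hq_nonneg : 0 ≤ᵐ[Pr] q := by
    refine (condExp_nonneg (ae_of_all _ fun ω => ?_)).trans_eq hq
    exact Set.indicator_nonneg (fun _ _ => zero_le_one) _
  have hset : ∀ s, MeasurableSet[m] s → ∀ B, MeasurableSet B →
      Pr (s ∩ (E ∩ X ⁻¹' B)) = (∫⁻ ω in s, ENNReal.ofReal (q ω) ∂Pr) * ν B := by
    intro s hs B hB
    have h1 := setIntegral_condExp hm
      ((integrable_const (1 : ℝ)).indicator (hmeas B hB) : Integrable _ Pr) hs
    rw [setIntegral_congr_ae (hm s hs) ((h B hB).mono fun ω hω _ => hω), integral_mul_const,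
      setIntegral_indicator (hmeas B hB), setIntegral_one_eq_measureReal] at h1
    rw [← ofReal_integral_eq_lintegral_ofReal hq_int.integrableOn (ae_restrict_of_ae hq_nonneg),
      ← ofReal_measureReal (μ := ν), ← ENNReal.ofReal_mul
        (setIntegral_nonneg_of_ae hq_nonneg), h1, ofReal_measureReal]
    rfl
  have hlaw : ∀ s, MeasurableSet[m] s → ∫⁻ ω in s ∩ E, g (X ω) ∂Pr
      = (∫⁻ ω in s, ENNReal.ofReal (q ω) ∂Pr) * ∫⁻ x, g x ∂ν := by
    intro s hs
    rw [← lintegral_map hg hX, ← smul_eq_mul, ← lintegral_smul_measure]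
    congr 1
    ext B hB
    rw [Measure.map_apply hX hB, Measure.restrict_apply (hX hB), Measure.smul_apply, smul_eq_mul,
      ← hset s hs B hB]
    congr 1
    ext ω
    simp only [Set.mem_inter_iff, Set.mem_preimage]
    tauto
  have hgX : Measurable fun ω => g (X ω) := hg.comp hX
  have htrim : ((Pr.restrict E).withDensity fun ω => g (X ω)).trim hm
      = (∫⁻ x, g x ∂ν) • (Pr.withDensity fun ω => ENNReal.ofReal (q ω)).trim hm := by
    refine @Measure.ext _ m _ _ fun s hs => ?_
    rw [trim_measurableSet_eq hm hs, withDensity_apply _ (hm s hs),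
      Measure.restrict_restrict (hm s hs), hlaw s hs, Measure.smul_apply,
      trim_measurableSet_eq hm hs, withDensity_apply _ (hm s hs), smul_eq_mul, mul_comm]
  have hfm : Measurable f := hf.mono hm le_rfl
  have e1 := lintegral_trim (μ := (Pr.restrict E).withDensity fun ω => g (X ω)) hm hf
  have e2 := lintegral_trim (μ := Pr.withDensity fun ω => ENNReal.ofReal (q ω)) hm hf
  rw [lintegral_withDensity_eq_lintegral_mul _ hgX hfm] at e1
  rw [lintegral_withDensity_eq_lintegral_mul₀ hq_int.aemeasurable.ennreal_ofReal
    hfm.aemeasurable] at e2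
  rw [htrim, lintegral_smul_measure, e2] at e1
  simp only [Pi.mul_apply, smul_eq_mul] at e1
  simp_rw [mul_comm (f _)]
  rw [← e1, mul_comm]

/-! ### The exponential supermartingale -/

/-- The exponent of the Hoeffding supermartingale for arm `k` after `t` rounds, with tilt `l`
around the value `c`: each pull of arm `k` with reward `y s` contributes `l (y s - c) - l ^ 2 / 8`,
where `l ^ 2 / 8` is Hoeffding's bound on the log-moment generating function of a centered
`[0, 1]`-valued reward. -/
noncomputable def tiltedSum {K : ℕ} (l c : ℝ) (a : ℕ → Fin K) (y : ℕ → ℝ) (k : Fin K) (t : ℕ) : ℝ :=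
  ∑ s ∈ Finset.range t, if a s = k then l * (y s - c) - l ^ 2 / 8 else 0

theorem tiltedSum_eq {N K : ℕ} (l c : ℝ) (a : ℕ → Fin K) (x : ℕ → Fin N → ℝ) (i : Fin N)
    (k : Fin K) (t : ℕ) (h : pullCount a t k ≠ 0) :
    tiltedSum l c a (fun s => x s i) k t
      = pullCount a t k * (l * (empMean a x t i k - c) - l ^ 2 / 8) := by
  have h' : (pullCount a t k : ℝ) ≠ 0 := by exact_mod_cast h
  have hsum : ∑ s ∈ (Finset.range t).filter (fun s => a s = k), x s i
      = pullCount a t k * empMean a x t i k := by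
    unfold empMean
    field_simp
  unfold tiltedSum
  rw [← Finset.sum_filter, Finset.sum_sub_distrib, ← Finset.mul_sum, Finset.sum_sub_distrib, hsum,
    Finset.sum_const, Finset.sum_const, nsmul_eq_mul, nsmul_eq_mul]
  change _ * (_ - (pullCount a t k : ℝ) * _) - (pullCount a t k : ℝ) * _ = _
  ring

theorem lintegral_exp_tilt_le_one {N : ℕ} {ν : Measure (Fin N → ℝ)} [IsProbabilityMeasure ν]
    (hν : ∀ᵐ x ∂ν, ∀ i, x i ∈ Set.Icc (0 : ℝ) 1) (i : Fin N) (l : ℝ) :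
    ∫⁻ x, ENNReal.ofReal (Real.exp (l * (x i - ∫ x, x i ∂ν) - l ^ 2 / 8)) ∂ν ≤ 1 := by
  have hsub := ProbabilityTheory.hasSubgaussianMGF_of_mem_Icc (μ := ν) (X := fun x => x i)
    (measurable_pi_apply i).aemeasurable (hν.mono fun x hx => hx i)
  have hint := hsub.integrable_exp_mul l
  have hle := hsub.mgf_le l
  simp_rw [Real.exp_sub]
  rw [← ofReal_integral_eq_lintegral_ofReal (hint.div_const _)
    (ae_of_all _ fun x => by positivity), integral_div]
  refine ENNReal.ofReal_le_one.2 (div_le_one_of_le₀ (hle.trans_eq ?_) (Real.exp_pos _).le)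
  congr 1
  norm_num
  ring

namespace IsEFRun

variable {N K T : ℕ} {Ω : Type*} {mΩ : MeasurableSpace Ω} {Pr : Measure Ω}
  {ν : Fin K → Measure (Fin N → ℝ)} {α : ℝ} {ℱ : Filtration ℕ mΩ}
  {P : ℕ → Ω → Fin K → ℝ} {A : ℕ → Ω → Fin K} {X : ℕ → Ω → Fin N → ℝ}

theorem measurableSet_arm (h : IsEFRun Pr ν α T ℱ P A X) {s t : ℕ} (hs : s < t) (ht : s ≤ T)
    (k : Fin K) : MeasurableSet[ℱ t] {ω | A s ω = k} :=
  ℱ.mono (Nat.succ_le_of_lt hs) _ (h.measurable_arm s ht (measurableSet_singleton k))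

theorem measurable_reward_apply (h : IsEFRun Pr ν α T ℱ P A X) {s t : ℕ} (hs : s < t)
    (ht : s ≤ T) (i : Fin N) : Measurable[ℱ t] fun ω => X s ω i :=
  (measurable_pi_apply i).comp
    ((h.measurable_reward s ht).mono (ℱ.mono (Nat.succ_le_of_lt hs)) le_rfl)

theorem measurable_pullCount (h : IsEFRun Pr ν α T ℱ P A X) {t : ℕ} (ht : t ≤ T + 1)
    (k : Fin K) : Measurable[ℱ t] fun ω => pullCount (fun s => A s ω) t k := by
  simp only [pullCount, Finset.card_filter]
  refine Finset.measurable_sum _ fun s hs => ?_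
  have hs' := Finset.mem_range.1 hs
  exact Measurable.ite (h.measurableSet_arm hs' (by omega) k) measurable_const measurable_const

theorem measurable_tiltedSum (h : IsEFRun Pr ν α T ℱ P A X) {t : ℕ} (ht : t ≤ T + 1)
    (l c : ℝ) (i : Fin N) (k : Fin K) :
    Measurable[ℱ t] fun ω => tiltedSum l c (fun s => A s ω) (fun s => X s ω i) k t := by
  unfold tiltedSum
  refine Finset.measurable_sum _ fun s hs => ?_
  have hs' := Finset.mem_range.1 hs
  exact Measurable.ite (h.measurableSet_arm hs' (by omega) k)
    ((((h.measurable_reward_apply hs' (by omega) i).sub_const c).const_mul l).sub_const _)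
    measurable_const

open scoped ENNReal in
theorem setLIntegral_arm (h : IsEFRun Pr ν α T ℱ P A X) [IsProbabilityMeasure Pr]
    (hν : ∀ k, IsProbabilityMeasure (ν k)) {t : ℕ} (ht : t ≤ T) (k : Fin K) {f : Ω → ℝ≥0∞}
    (hf : Measurable[ℱ t] f) {g : (Fin N → ℝ) → ℝ≥0∞} (hg : Measurable g) :
    ∫⁻ ω in {ω | A t ω = k}, f ω * g (X t ω) ∂Pr
      = (∫⁻ ω, f ω * ENNReal.ofReal (P t ω k) ∂Pr) * ∫⁻ x, g x ∂(ν k) :=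
  have := hν k
  setLIntegral_mul_comp_eq_of_condExp (ℱ.le t)
    (ℱ.le _ _ (h.measurableSet_arm (Nat.lt_succ_self t) ht k))
    ((h.measurable_reward t ht).mono (ℱ.le _) le_rfl) (h.sample t ht k) hf hg

/-- The exponential of the tilted sum is a supermartingale started at `1`. -/
theorem lintegral_exp_tiltedSum_le_one (h : IsEFRun Pr ν α T ℱ P A X) [IsProbabilityMeasure Pr]
    (hν : ∀ k, IsProbabilityMeasure (ν k))
    (hν01 : ∀ k, ∀ᵐ x ∂(ν k), ∀ i, x i ∈ Set.Icc (0 : ℝ) 1) (l : ℝ) (i : Fin N) (k : Fin K)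
    {t : ℕ} (ht : t ≤ T + 1) :
    ∫⁻ ω, ENNReal.ofReal (Real.exp
      (tiltedSum l (trueMean ν i k) (fun s => A s ω) (fun s => X s ω i) k t)) ∂Pr ≤ 1 := by
  induction t with
  | zero => simp [tiltedSum]
  | succ t ih =>
    refine le_trans ?_ (ih (by omega))
    have hZ := ((h.measurable_tiltedSum (t := t) (by omega) l
      (trueMean ν i k) i k).exp).ennreal_ofReal
    set Z : Ω → ENNReal := fun ω => ENNReal.ofReal (Real.exp
      (tiltedSum l (trueMean ν i k) (fun s => A s ω) (fun s => X s ω i) k t)) with hZdef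
    have hE : MeasurableSet {ω | A t ω = k} :=
      ℱ.le _ _ (h.measurableSet_arm (Nat.lt_succ_self t) (by omega) k)
    rw [← lintegral_add_compl _ hE, ← lintegral_add_compl Z hE]
    refine add_le_add ?_ (le_of_eq ?_)
    · have hg : Measurable fun x : Fin N → ℝ =>
          ENNReal.ofReal (Real.exp (l * (x i - trueMean ν i k) - l ^ 2 / 8)) := by fun_prop
      have h1 := h.setLIntegral_arm hν (by omega : t ≤ T) k hZ hg
      have h2 := h.setLIntegral_arm hν (by omega : t ≤ T) k hZ (g := fun _ => 1) measurable_const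
      have := hν k
      simp only [mul_one, lintegral_one, measure_univ] at h2
      calc _ = ∫⁻ ω in {ω | A t ω = k}, Z ω *
              ENNReal.ofReal (Real.exp (l * (X t ω i - trueMean ν i k) - l ^ 2 / 8)) ∂Pr := by
            refine setLIntegral_congr_fun hE fun ω hω => ?_
            have hω' : A t ω = k := hω
            simp only [hZdef]
            rw [← ENNReal.ofReal_mul (Real.exp_pos _).le, ← Real.exp_add, tiltedSum,
              Finset.sum_range_succ, if_pos hω']
            rfl
        _ ≤ _ := by
            rw [h1, h2]
            exact mul_le_of_le_one_right (zero_le) (lintegral_exp_tilt_le_one (hν01 k) i l)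
    · refine setLIntegral_congr_fun hE.compl fun ω hω => ?_
      have hω' : ¬ A t ω = k := hω
      simp only [hZdef]
      rw [tiltedSum, Finset.sum_range_succ, if_neg hω', add_zero]
      rfl

theorem measureReal_le_tiltedSum_le (h : IsEFRun Pr ν α T ℱ P A X) [IsProbabilityMeasure Pr]
    (hν : ∀ k, IsProbabilityMeasure (ν k))
    (hν01 : ∀ k, ∀ᵐ x ∂(ν k), ∀ i, x i ∈ Set.Icc (0 : ℝ) 1) (l u : ℝ) (i : Fin N) (k : Fin K)
    {t : ℕ} (ht : t ≤ T + 1) :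
    Pr.real {ω | u ≤ tiltedSum l (trueMean ν i k) (fun s => A s ω) (fun s => X s ω i) k t}
      ≤ Real.exp (-u) := by
  have hmeas := (((h.measurable_tiltedSum ht l (trueMean ν i k) i k).mono
    (ℱ.le t) le_rfl).exp).ennreal_ofReal
  have hM := meas_ge_le_lintegral_div (μ := Pr) hmeas.aemeasurable
    (ε := ENNReal.ofReal (Real.exp u)) (by simp [Real.exp_pos]) ENNReal.ofReal_ne_top
  refine ENNReal.toReal_le_of_le_ofReal (Real.exp_pos _).le ?_
  refine ((measure_mono fun ω hω => ?_).trans hM).trans ?_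
  · exact ENNReal.ofReal_le_ofReal (Real.exp_le_exp.2 hω)
  · rw [Real.exp_neg, ENNReal.ofReal_inv_of_pos (Real.exp_pos _), ← one_div]
    exact ENNReal.div_le_div_right (h.lintegral_exp_tiltedSum_le_one hν hν01 l i k ht) _

/-- Outside an event of probability at most `1 / (t (t + 1))` all empirical means of the arms pulled
so far are within their confidence radii. The number `n` of pulls of an arm is random, so the
tilt `± 4 √(2 ln (N K t) / n)`, which is the optimal one for `n` pulls, is applied for every possible
value of `n`. For `t = 0` the bound is `1 / 0 = 0`, and no arm has been pulled. -/
theorem exists_confidence_event (h : IsEFRun Pr ν α T ℱ P A X) [IsProbabilityMeasure Pr]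
    (hN : 2 ≤ N) (hK : 1 ≤ K) (hν : ∀ k, IsProbabilityMeasure (ν k))
    (hν01 : ∀ k, ∀ᵐ x ∂(ν k), ∀ i, x i ∈ Set.Icc (0 : ℝ) 1) {t : ℕ} (ht : t ≤ T) :
    ∃ B : Set Ω, MeasurableSet B ∧ Pr.real B ≤ 1 / ((t : ℝ) * (t + 1)) ∧ ∀ ω ∉ B, ∀ i k,
      pullCount (fun s => A s ω) t k ≠ 0 →
        |empMean (fun s => A s ω) (fun s => X s ω) t i k - trueMean ν i k|
          ≤ confRadius N K t (pullCount (fun s => A s ω) t k) := by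
  rcases Nat.eq_zero_or_pos t with rfl | ht0
  · exact ⟨∅, MeasurableSet.empty, by simp, fun ω _ i k hn => absurd (by simp [pullCount]) hn⟩
  have hN' : (2 : ℝ) ≤ N := by exact_mod_cast hN
  have hK' : (1 : ℝ) ≤ K := by exact_mod_cast hK
  have ht' : (1 : ℝ) ≤ t := by exact_mod_cast ht0
  set x : ℝ := (N : ℝ) * K * t with hx
  have hx2 : 2 * (t : ℝ) ≤ x := by
    have : 2 ≤ (N : ℝ) * K := by nlinarith
    exact mul_le_mul_of_nonneg_right this (by linarith)
  have hx0 : 0 < x := by linarith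
  have hL : 0 ≤ Real.log x := Real.log_nonneg (by linarith)
  let S : ℝ → Fin N → Fin K → Set Ω := fun l i k =>
    {ω | 4 * Real.log x ≤
      tiltedSum l (trueMean ν i k) (fun s => A s ω) (fun s => X s ω i) k t}
  have hS : ∀ l i k, MeasurableSet (S l i k) := fun l i k =>
    measurableSet_le measurable_const
      ((h.measurable_tiltedSum (by omega) l (trueMean ν i k) i k).mono (ℱ.le t) le_rfl)
  have hPS : ∀ l i k, Pr.real (S l i k) ≤ (x ^ 4)⁻¹ := fun l i k => by
    refine (h.measureReal_le_tiltedSum_le hν hν01 l _ i k (by omega)).trans_eq ?_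
    rw [Real.exp_neg, show 4 * Real.log x = Real.log (x ^ 4) by rw [Real.log_pow]; norm_num,
      Real.exp_log (by positivity)]
  let I : Finset ((Fin N × Fin K) × ℕ) := Finset.univ ×ˢ Finset.Icc 1 t
  refine ⟨⋃ z ∈ I, S (4 * confRadius N K t z.2) z.1.1 z.1.2 ∪
    S (-(4 * confRadius N K t z.2)) z.1.1 z.1.2, ?_, ?_, ?_⟩
  · exact Finset.measurableSet_biUnion _ fun z _ => (hS _ _ _).union (hS _ _ _)
  · calc _ ≤ ∑ z ∈ I, 2 * (x ^ 4)⁻¹ := by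
          refine (measureReal_biUnion_finset_le _ _).trans (Finset.sum_le_sum fun z _ => ?_)
          refine (measureReal_union_le _ _).trans ?_
          linarith [hPS (4 * confRadius N K t z.2) z.1.1 z.1.2,
            hPS (-(4 * confRadius N K t z.2)) z.1.1 z.1.2]
      _ = 2 / x ^ 3 := by
          rw [Finset.sum_const, nsmul_eq_mul, Finset.card_product]
          simp only [Finset.card_univ, Fintype.card_prod, Fintype.card_fin, Nat.card_Icc,
            Nat.add_sub_cancel]
          push_cast
          rw [← hx]
          field_simp
      _ ≤ 2 / (2 * t) ^ 3 := by gcongr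
      _ ≤ 1 / ((t : ℝ) * (t + 1)) := by
          rw [div_le_div_iff₀ (by positivity) (by positivity)]
          nlinarith [mul_nonneg (sub_nonneg.2 ht') (sub_nonneg.2 ht'), pow_pos
            (show (0 : ℝ) < t by linarith) 3, mul_nonneg (sub_nonneg.2 ht') (sq_nonneg (t : ℝ))]
  · intro ω hω i k hn
    by_contra! hlt
    refine hω ?_
    set n := pullCount (fun s => A s ω) t k with hndef
    have hmem : ((i, k), n) ∈ I := by
      simp only [I, Finset.mem_product, Finset.mem_univ, Finset.mem_Icc, true_and]
      exact ⟨Nat.one_le_iff_ne_zero.2 hn, pullCount_le _ _ _⟩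
    refine Set.mem_biUnion hmem ?_
    have hn0 : (0 : ℝ) < n := by exact_mod_cast Nat.pos_of_ne_zero hn
    have hr0 : 0 ≤ confRadius N K t n := Real.sqrt_nonneg _
    have hr2 : n * confRadius N K t n ^ 2 = 2 * Real.log x := by
      unfold confRadius
      rw [← hx, Real.sq_sqrt (by positivity)]
      field_simp
    have h1 := tiltedSum_eq (4 * confRadius N K t n) (trueMean ν i k) (fun s => A s ω)
      (fun s => X s ω) i k t hn
    have h2 := tiltedSum_eq (-(4 * confRadius N K t n)) (trueMean ν i k) (fun s => A s ω)
      (fun s => X s ω) i k t hn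
    rw [← hndef] at h1 h2
    rcases lt_abs.1 hlt with hlt | hlt
    · left
      refine le_of_le_of_eq ?_ h1.symm
      nlinarith [mul_le_mul_of_nonneg_left hlt.le (mul_nonneg hn0.le hr0)]
    · right
      refine le_of_le_of_eq ?_ h2.symm
      nlinarith [mul_le_mul_of_nonneg_left hlt.le (mul_nonneg hn0.le hr0)]

/-! ### Almost sure properties of a run -/

theorem ae_policy_mem (h : IsEFRun Pr ν α T ℱ P A X) {t : ℕ} (ht : t ≤ T) :
    ∀ᵐ ω ∂Pr, P t ω ∈ stdSimplex ℝ (Fin K) := by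
  rcases lt_or_ge t K with htK | htK
  · filter_upwards [h.init t ht htK] with ω hω
    rw [hω]
    exact single_mem_stdSimplex ℝ _
  · exact (h.optimize t ht htK).mono fun ω hω => hω.1

theorem ae_init_arm (h : IsEFRun Pr ν α T ℱ P A X) [IsProbabilityMeasure Pr]
    (hν : ∀ k, IsProbabilityMeasure (ν k)) {t : ℕ} (ht : t ≤ T) (htK : t < K) :
    ∀ᵐ ω ∂Pr, A t ω = ⟨t, htK⟩ := by
  have hne : ∀ k : Fin K, k ≠ ⟨t, htK⟩ → ∀ᵐ ω ∂Pr, A t ω ≠ k := fun k hk => by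
    have h1 := h.setLIntegral_arm hν ht k (f := fun _ => 1) (g := fun _ => 1)
      measurable_const measurable_const
    have h2 : ∫⁻ ω, ENNReal.ofReal (P t ω k) ∂Pr = 0 := by
      rw [← lintegral_zero (μ := Pr)]
      refine lintegral_congr_ae ((h.init t ht htK).mono fun ω hω => ?_)
      simp [hω, hk]
    simp only [mul_one, one_mul, h2, zero_mul, lintegral_one, Measure.restrict_apply_univ] at h1
    rw [ae_iff]
    simpa using h1
  have hall : ∀ᵐ ω ∂Pr, ∀ k : Fin K, k ≠ ⟨t, htK⟩ → A t ω ≠ k := by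
    rw [ae_all_iff]
    intro k
    by_cases hk : k = ⟨t, htK⟩
    · simp [hk]
    · exact (hne k hk).mono fun ω hω _ => hω
  filter_upwards [hall] with ω hω
  by_contra hne
  exact hω _ hne rfl

theorem ae_pullCount_ne_zero (h : IsEFRun Pr ν α T ℱ P A X) [IsProbabilityMeasure Pr]
    (hν : ∀ k, IsProbabilityMeasure (ν k)) {t : ℕ} (ht : t ≤ T) (hKt : K ≤ t) :
    ∀ᵐ ω ∂Pr, ∀ k, pullCount (fun s => A s ω) t k ≠ 0 := by
  rw [ae_all_iff]
  intro k
  filter_upwards [h.ae_init_arm hν (t := k) (by omega) k.2] with ω hω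
  have := pullCount_pos (a := fun s => A s ω) (show (k : ℕ) < t by omega)
  rw [hω] at this
  exact this.ne'

theorem ae_reward_mem_Icc (h : IsEFRun Pr ν α T ℱ P A X) [IsProbabilityMeasure Pr]
    (hν : ∀ k, IsProbabilityMeasure (ν k))
    (hν01 : ∀ k, ∀ᵐ x ∂(ν k), ∀ i, x i ∈ Set.Icc (0 : ℝ) 1) :
    ∀ᵐ ω ∂Pr, ∀ t ≤ T, ∀ i, X t ω i ∈ Set.Icc (0 : ℝ) 1 := by
  rw [ae_all_iff]
  intro t
  by_cases ht : t ≤ T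
  swap
  · simp [ht]
  let C : Set (Fin N → ℝ) := {x | ∀ i, x i ∈ Set.Icc (0 : ℝ) 1}
  have hC : MeasurableSet C := by
    have : C = ⋂ i, {x | x i ∈ Set.Icc (0 : ℝ) 1} := by ext; simp [C]
    rw [this]
    exact MeasurableSet.iInter fun i => measurable_pi_apply i measurableSet_Icc
  have hXm : Measurable (X t) := (h.measurable_reward t ht).mono (ℱ.le _) le_rfl
  have hall : ∀ᵐ ω ∂Pr, ∀ k : Fin K, A t ω = k → X t ω ∈ C := by
    rw [ae_all_iff]
    intro k
    have h1 := h.setLIntegral_arm hν ht k (f := fun _ => 1) (g := Cᶜ.indicator fun _ => 1)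
      measurable_const (measurable_const.indicator hC.compl)
    have h2 : ν k Cᶜ = 0 := by
      have := hν01 k
      rw [ae_iff] at this
      exact this
    rw [lintegral_indicator_const hC.compl, h2, mul_zero, mul_zero] at h1
    have hEm : MeasurableSet {ω | A t ω = k} :=
      ℱ.le _ _ (h.measurableSet_arm (Nat.lt_succ_self t) ht k)
    have hgm : Measurable fun ω => (1 : ENNReal) * Cᶜ.indicator (fun _ => 1) (X t ω) :=
      ((measurable_const.indicator hC.compl).comp hXm).const_mul 1
    rw [lintegral_eq_zero_iff hgm, Filter.EventuallyEq, ae_restrict_iff' hEm] at h1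
    filter_upwards [h1] with ω hω hA
    by_contra hmem
    have := hω hA
    simp [Set.indicator_of_mem (show X t ω ∈ Cᶜ from hmem)] at this
  filter_upwards [hall] with ω hω _
  exact hω _ rfl

end IsEFRun

/-! ### Expected regret -/

theorem trueMean_mem_Icc {N K : ℕ} {ν : Fin K → Measure (Fin N → ℝ)}
    (hν : ∀ k, IsProbabilityMeasure (ν k))
    (hν01 : ∀ k, ∀ᵐ x ∂(ν k), ∀ i, x i ∈ Set.Icc (0 : ℝ) 1) (i : Fin N) (k : Fin K) :
    trueMean ν i k ∈ Set.Icc (0 : ℝ) 1 := by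
  have := hν k
  have hint : Integrable (fun x : Fin N → ℝ => x i) (ν k) :=
    Integrable.of_mem_Icc 0 1 (measurable_pi_apply i).aemeasurable ((hν01 k).mono fun x hx => hx i)
  refine ⟨integral_nonneg_of_ae ((hν01 k).mono fun x hx => (hx i).1), ?_⟩
  refine (integral_mono_ae hint (integrable_const 1) ((hν01 k).mono fun x hx => (hx i).2)).trans ?_
  simp

namespace IsEFRun

variable {N K T : ℕ} {Ω : Type*} {mΩ : MeasurableSpace Ω} {Pr : Measure Ω}
  {ν : Fin K → Measure (Fin N → ℝ)} {α : ℝ} {ℱ : Filtration ℕ mΩ}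
  {P : ℕ → Ω → Fin K → ℝ} {A : ℕ → Ω → Fin K} {X : ℕ → Ω → Fin N → ℝ}

theorem measurable_confRadius (h : IsEFRun Pr ν α T ℱ P A X) {t : ℕ} (ht : t ≤ T) (k : Fin K) :
    Measurable[ℱ t] fun ω => confRadius N K t (pullCount (fun s => A s ω) t k) :=
  (measurable_from_top (f := fun n : ℕ => confRadius N K t n)).comp
    (h.measurable_pullCount (by omega) k)

theorem integrable_confRadius (h : IsEFRun Pr ν α T ℱ P A X) [IsProbabilityMeasure Pr] {t : ℕ}
    (ht : t ≤ T) (k : Fin K) :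
    Integrable (fun ω => confRadius N K t (pullCount (fun s => A s ω) t k)) Pr := by
  refine Integrable.of_mem_Icc 0 (∑ n ∈ Finset.range (t + 1), confRadius N K t n)
    ((h.measurable_confRadius ht k).mono (ℱ.le t) le_rfl).aemeasurable
    (ae_of_all _ fun ω => ⟨Real.sqrt_nonneg _, ?_⟩)
  exact Finset.single_le_sum (f := fun n => confRadius N K t n) (fun n _ => Real.sqrt_nonneg _)
    (Finset.mem_range.2 (Nat.lt_succ_of_le (pullCount_le _ _ _)))

theorem measurable_policy_apply (h : IsEFRun Pr ν α T ℱ P A X) {t : ℕ} (ht : t ≤ T) (k : Fin K) :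
    Measurable fun ω => P t ω k :=
  (measurable_pi_apply k).comp ((h.measurable_policy t ht).mono (ℱ.le t) le_rfl)

theorem integrable_policy_mul_confRadius (h : IsEFRun Pr ν α T ℱ P A X) [IsProbabilityMeasure Pr]
    {t : ℕ} (ht : t ≤ T) (k : Fin K) :
    Integrable (fun ω => P t ω k * confRadius N K t (pullCount (fun s => A s ω) t k)) Pr := by
  refine (h.integrable_confRadius ht k).bdd_mul (c := 1)
    (h.measurable_policy_apply ht k).aestronglyMeasurable ?_
  filter_upwards [h.ae_policy_mem ht] with ω hω
  rw [Real.norm_eq_abs, abs_of_nonneg (hω.1 k), ← hω.2]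
  exact Finset.single_le_sum (fun j _ => hω.1 j) (Finset.mem_univ k)

theorem confRadius_arm_eq_sum_indicator (t : ℕ) (ω : Ω) :
    confRadius N K t (pullCount (fun s => A s ω) t (A t ω)) = ∑ k, {ω | A t ω = k}.indicator
      (fun ω => confRadius N K t (pullCount (fun s => A s ω) t k)) ω := by
  rw [Finset.sum_eq_single (A t ω)]
  · rw [Set.indicator_of_mem]
    exact Eq.refl (A t ω)
  · intro k _ hk
    rw [Set.indicator_of_notMem]
    exact fun hω => hk (Eq.symm hω)
  · simp

theorem integrable_confRadius_arm (h : IsEFRun Pr ν α T ℱ P A X) [IsProbabilityMeasure Pr]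
    {t : ℕ} (ht : t ≤ T) :
    Integrable (fun ω => confRadius N K t (pullCount (fun s => A s ω) t (A t ω))) Pr := by
  simp_rw [confRadius_arm_eq_sum_indicator]
  exact integrable_finsetSum _ fun k _ => (h.integrable_confRadius ht k).indicator
    (ℱ.le _ _ (h.measurableSet_arm (Nat.lt_succ_self t) ht k))

/-- Since the arm is drawn from the policy, the policy average of the confidence radii and the
radius of the arm drawn have the same expectation. -/
theorem integral_sum_policy_mul_confRadius (h : IsEFRun Pr ν α T ℱ P A X)
    [IsProbabilityMeasure Pr] (hν : ∀ k, IsProbabilityMeasure (ν k)) {t : ℕ} (ht : t ≤ T) :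
    ∫ ω, ∑ k, P t ω k * confRadius N K t (pullCount (fun s => A s ω) t k) ∂Pr
      = ∫ ω, confRadius N K t (pullCount (fun s => A s ω) t (A t ω)) ∂Pr := by
  have hE : ∀ k, MeasurableSet {ω | A t ω = k} := fun k =>
    ℱ.le _ _ (h.measurableSet_arm (Nat.lt_succ_self t) ht k)
  simp_rw [confRadius_arm_eq_sum_indicator]
  rw [integral_finsetSum _ fun k _ => h.integrable_policy_mul_confRadius ht k,
    integral_finsetSum _ fun k _ => (h.integrable_confRadius ht k).indicator (hE k)]
  refine Finset.sum_congr rfl fun k _ => ?_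
  have hr := h.measurable_confRadius ht k
  have h1 := h.setLIntegral_arm hν ht k hr.ennreal_ofReal (g := fun _ => 1) measurable_const
  have := hν k
  simp only [mul_one, lintegral_one, measure_univ] at h1
  rw [integral_indicator (hE k), integral_eq_lintegral_of_nonneg_ae,
    integral_eq_lintegral_of_nonneg_ae, h1]
  · congr 1
    refine lintegral_congr fun ω => ?_
    rw [mul_comm (P t ω k)]
    exact ENNReal.ofReal_mul (Real.sqrt_nonneg _)
  · exact ae_of_all _ fun ω => Real.sqrt_nonneg _
  · exact (hr.mono (ℱ.le t) le_rfl).aestronglyMeasurable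
  · filter_upwards [h.ae_policy_mem ht] with ω hω
    exact mul_nonneg (hω.1 k) (Real.sqrt_nonneg _)
  · exact (h.integrable_policy_mul_confRadius ht k).aestronglyMeasurable

theorem integrable_disparity_sub (h : IsEFRun Pr ν α T ℱ P A X) [IsProbabilityMeasure Pr]
    (hN : 2 ≤ N) {m : Fin N → Fin K → ℝ} (hm : ∀ i k, m i k ∈ Set.Icc (0 : ℝ) 1) (c : ℝ) {t : ℕ}
    (ht : t ≤ T) : Integrable (fun ω => disparity m (P t ω) - c) Pr := by
  refine Integrable.sub (Integrable.of_mem_Icc 0 1 ?_ ?_) (integrable_const c)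
  · exact ((continuous_disparity m).measurable.comp
      ((h.measurable_policy t ht).mono (ℱ.le t) le_rfl)).aemeasurable
  · exact (h.ae_policy_mem ht).mono fun ω hω => ⟨disparity_nonneg hN _ _, disparity_le_one hN hω hm⟩

/-- Expected regret of a single round: an initial round costs at most `1`, and a later one twice
the bonus plus the probability that some confidence interval fails. -/
theorem integral_disparity_sub_le (h : IsEFRun Pr ν 4 T ℱ P A X) [IsProbabilityMeasure Pr]
    (hN : 2 ≤ N) (hK : 1 ≤ K) (hν : ∀ k, IsProbabilityMeasure (ν k))
    (hν01 : ∀ k, ∀ᵐ x ∂(ν k), ∀ i, x i ∈ Set.Icc (0 : ℝ) 1) {q : Fin K → ℝ}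
    (hq : q ∈ stdSimplex ℝ (Fin K)) {t : ℕ} (ht : t ≤ T) :
    ∫ ω, (disparity (trueMean ν) (P t ω) - disparity (trueMean ν) q) ∂Pr
      ≤ 8 * ∫ ω, confRadius N K t (pullCount (fun s => A s ω) t (A t ω)) ∂Pr
        + (if t < K then 1 else 0) + 1 / ((t : ℝ) * (t + 1)) := by
  obtain ⟨B, hBm, hBP, hB⟩ := h.exists_confidence_event hN hK hν hν01 ht
  have hm := trueMean_mem_Icc hν hν01
  have hint := h.integrable_disparity_sub hN hm (disparity (trueMean ν) q) ht
  have hbonus : Integrable (fun ω => 8 * ∑ k, P t ω k *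
      confRadius N K t (pullCount (fun s => A s ω) t k)) Pr :=
    (integrable_finsetSum _ fun k _ => h.integrable_policy_mul_confRadius ht k).const_mul 8
  have hconst : Integrable (fun _ : Ω => if t < K then (1 : ℝ) else 0) Pr := integrable_const _
  have hind : Integrable (B.indicator fun _ => (1 : ℝ)) Pr := (integrable_const 1).indicator hBm
  have hae : ∀ᵐ ω ∂Pr, disparity (trueMean ν) (P t ω) - disparity (trueMean ν) q
      ≤ 8 * ∑ k, P t ω k * confRadius N K t (pullCount (fun s => A s ω) t k)
        + (if t < K then 1 else 0) + B.indicator (fun _ => (1 : ℝ)) ω := by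
    have hq0 := disparity_nonneg hN (trueMean ν) q
    have hind0 : ∀ ω, 0 ≤ B.indicator (fun _ => (1 : ℝ)) ω := fun ω =>
      Set.indicator_nonneg (fun _ _ => zero_le_one) ω
    rcases lt_or_ge t K with htK | htK
    · filter_upwards [h.ae_policy_mem ht] with ω hω
      have hb : 0 ≤ ∑ k, P t ω k * confRadius N K t (pullCount (fun s => A s ω) t k) :=
        Finset.sum_nonneg fun k _ => mul_nonneg (hω.1 k) (Real.sqrt_nonneg _)
      rw [if_pos htK]
      linarith [disparity_le_one hN hω hm, hind0 ω]
    · filter_upwards [h.optimize t ht htK, h.ae_pullCount_ne_zero hν ht htK,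
        h.ae_reward_mem_Icc hν hν01] with ω hω hn hX
      rw [if_neg (not_lt.2 htK)]
      by_cases hωB : ω ∈ B
      · have hb : 0 ≤ ∑ k, P t ω k * confRadius N K t (pullCount (fun s => A s ω) t k) :=
          Finset.sum_nonneg fun k _ => mul_nonneg (hω.1.1 k) (Real.sqrt_nonneg _)
        rw [Set.indicator_of_mem hωB]
        linarith [disparity_le_one hN hω.1 hm]
      · rw [Set.indicator_of_notMem hωB, add_zero, add_zero]
        exact disparity_sub_le_of_isOptimalPolicy hN hq hm
          (empMean_mem_Icc fun s hs => hX s (by omega))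
          (fun i k => hB ω hωB i k (hn k)) hω
  refine (integral_mono_ae hint ((hbonus.add hconst).add hind) hae).trans ?_
  rw [integral_add' (hbonus.add hconst) hind, integral_add' hbonus hconst, integral_const_mul,
    h.integral_sum_policy_mul_confRadius hν ht, integral_const, probReal_univ, one_smul,
    integral_indicator_const _ hBm, smul_eq_mul, mul_one]
  linarith

end IsEFRun

theorem sum_one_div_mul_succ_le (n : ℕ) :
    ∑ t ∈ Finset.range n, 1 / ((t : ℝ) * (t + 1)) ≤ 1 := by
  rcases n with _ | n
  · simp
  have : ∑ t ∈ Finset.range (n + 1), 1 / ((t : ℝ) * (t + 1)) = 1 - 1 / ((n : ℝ) + 1) := by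
    induction n with
    | zero => simp
    | succ n ih =>
      rw [Finset.sum_range_succ, ih]
      push_cast
      field_simp
      ring
  rw [this]
  have : 0 ≤ 1 / ((n : ℝ) + 1) := by positivity
  linarith

theorem sum_ite_lt_le {K T : ℕ} (hT : 1 ≤ T) :
    ∑ t ∈ Finset.range (T + 1), (if t < K then (1 : ℝ) else 0) ≤ 2 * √((K : ℝ) * T) := by
  rw [← Finset.sum_filter, Finset.sum_const, nsmul_eq_mul, mul_one]
  set c := ((Finset.range (T + 1)).filter fun t => t < K).card
  have h1 : (c : ℝ) ≤ K := by
    have : c ≤ (Finset.range K).card := Finset.card_le_card fun t ht => by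
      simpa using (Finset.mem_filter.1 ht).2
    rw [Finset.card_range] at this
    exact_mod_cast this
  have h2 : (c : ℝ) ≤ T + 1 := by
    have : c ≤ T + 1 := (Finset.card_filter_le _ _).trans_eq (Finset.card_range _)
    exact_mod_cast this
  have hT' : (1 : ℝ) ≤ T := by exact_mod_cast hT
  have hc : (0 : ℝ) ≤ c := Nat.cast_nonneg c
  have : (c : ℝ) / 2 ≤ √((K : ℝ) * T) := by
    refine Real.le_sqrt_of_sq_le ?_
    nlinarith [mul_le_mul h1 h2 hc (hc.trans h1)]
  linarith

end FairBandit

theorem mainTheorem3 :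
    ∃ C : ℝ, 0 < C ∧
      ∀ (N K T : ℕ), 2 ≤ N → 1 ≤ K → 1 ≤ T →
      ∀ (ν : Fin K → Measure (Fin N → ℝ)),
        (∀ k, IsProbabilityMeasure (ν k)) →
        (∀ k, ∀ᵐ x ∂(ν k), ∀ i, x i ∈ Set.Icc (0 : ℝ) 1) →
      ∀ (pstar : Fin K → ℝ),
        FairBandit.IsOptimalPolicy (FairBandit.disparity (FairBandit.trueMean ν)) pstar →
      ∀ (Ω : Type*) (mΩ : MeasurableSpace Ω) (Pr : Measure Ω), IsProbabilityMeasure Pr →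
      ∀ (ℱ : Filtration ℕ mΩ) (P : ℕ → Ω → Fin K → ℝ) (A : ℕ → Ω → Fin K)
        (X : ℕ → Ω → Fin N → ℝ),
        FairBandit.IsEFRun Pr ν 4 T ℱ P A X →
        Integrable
            (fun ω => FairBandit.efRegret (FairBandit.trueMean ν) pstar (fun t => P t ω) T) Pr ∧
          ∫ ω, FairBandit.efRegret (FairBandit.trueMean ν) pstar (fun t => P t ω) T ∂Pr
            ≤ C * Real.sqrt ((K : ℝ) * (T : ℝ) * Real.log ((N : ℝ) * (K : ℝ) * (T : ℝ))) := by
  -- `8 * 6` from the confidence radii, `2 * 2` from the initial rounds, `2` from the failures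
  refine ⟨54, by norm_num, ?_⟩
  intro N K T hN hK hT ν hν hν01 pstar hpstar Ω mΩ Pr hPr ℱ P A X h
  have hle : ∀ t ∈ Finset.range (T + 1), t ≤ T := fun t ht =>
    Nat.lt_succ_iff.1 (Finset.mem_range.1 ht)
  have hint : ∀ t ∈ Finset.range (T + 1), Integrable (fun ω =>
      FairBandit.disparity (FairBandit.trueMean ν) (P t ω)
        - FairBandit.disparity (FairBandit.trueMean ν) pstar) Pr := fun t ht =>
    h.integrable_disparity_sub hN (FairBandit.trueMean_mem_Icc hν hν01) _ (hle t ht)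
  unfold FairBandit.efRegret
  refine ⟨integrable_finsetSum _ hint, ?_⟩
  have hrad : ∑ t ∈ Finset.range (T + 1), ∫ ω, FairBandit.confRadius N K t
      (FairBandit.pullCount (fun s => A s ω) t (A t ω)) ∂Pr
      ≤ 6 * √((K : ℝ) * T * Real.log ((N : ℝ) * K * T)) := by
    have hi := fun t (ht : t ∈ Finset.range (T + 1)) => h.integrable_confRadius_arm (hle t ht)
    rw [← integral_finsetSum _ hi]
    refine (integral_mono (integrable_finsetSum _ hi) (integrable_const _) fun ω =>
      FairBandit.sum_confRadius_le (by omega) hK hT fun s => A s ω).trans ?_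
    simp
  have hN' : (2 : ℝ) ≤ N := by exact_mod_cast hN
  have hK' : (1 : ℝ) ≤ K := by exact_mod_cast hK
  have hT' : (1 : ℝ) ≤ T := by exact_mod_cast hT
  have hKT : 1 ≤ (K : ℝ) * T := by nlinarith
  -- `ln (N K T) ≥ ln 2 ≥ 1 / 4` absorbs the terms without a logarithm
  have hlog : 1 / 4 ≤ Real.log ((N : ℝ) * K * T) := by
    have : Real.log 2 ≤ Real.log ((N : ℝ) * K * T) :=
      Real.log_le_log (by norm_num) (by rw [mul_assoc]; nlinarith)
    linarith [Real.log_two_gt_d9]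
  have hroot : √((K : ℝ) * T) ≤ 2 * √((K : ℝ) * T * Real.log ((N : ℝ) * K * T)) := by
    rw [Real.sqrt_le_left (by positivity), mul_pow, Real.sq_sqrt (by positivity)]
    nlinarith
  have hone : 1 ≤ √((K : ℝ) * T) := Real.one_le_sqrt.2 hKT
  rw [integral_finsetSum _ hint]
  refine (Finset.sum_le_sum fun t ht =>
    h.integral_disparity_sub_le hN hK hν hν01 hpstar.1 (hle t ht)).trans ?_
  rw [Finset.sum_add_distrib, Finset.sum_add_distrib, ← Finset.mul_sum]
  linarith [FairBandit.sum_one_div_mul_succ_le (T + 1), FairBandit.sum_ite_lt_le (K := K) hT]
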